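/- Let $k\ge 0$, let $n_1,\dots,n_k\ge 1$ be integers, put $G=\mathbb{Z}_{n_1}\times\cdots\times\mathbb{Z}_{n_k}$ (written additively), and let $A\subset\mathbb{C}^*$ be a finite subgroup. A $G$-graded twisted $\mathbb{C}$-algebra is a (not necessarily associative) $\mathbb{C}$-algebra $W=\bigoplus_{g\in G}W_g$ with $W_aW_b\subset W_{a+b}$ and identity element $1\in W_0$, such that every $W_g$ is one-dimensional and $w_aw_b\neq 0$ for all nonzero $w_a\in W_a$, $w_b\in W_b$. A graded basis $\{w_g\}_{g\in G}$ (a choice of a nonzero $w_g\in W_g$ for each $g$) has the structure constant $C:G\times G\to\mathbb{C}^*$ defined by $w_aw_b=C(a,b)\,w_{a+b}$; put $$r(a,b,c)=C(b,c)\,C(a+b,c)^{-1}\,C(a,b+c)\,C(a,b)^{-1},$$ which does not depend on the graded basis. $W$ is called $(1,2)$-symmetric if $r(a,b,c)=r(b,a,c)$ for all $a,b,c\in G$, and it has structure constants in $A$ if $C$ takes values in $A$ for some graded basis of $W$. Two such algebras are graded-isomorphic if there is an isomorphism of unital $\mathbb{C}$-algebras between them that preserves the grading. Then the number of graded-isomorphism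 classes of $(1,2)$-symmetric $G$-graded twisted $\mathbb{C}$-algebras with structure constants in $A$ is finite and equals $$\prod_{i=1}^{k}|R_{n_i}|^{|G|-(k+1)}\ \prod_{1\le i<j\le k}|R_{n_in_j}|,$$ where $R_n=\{\omega\in A:\omega^n=1\}$. (The exponent $|G|-(k+1)$ is an integer, which can be negative when some $n_i=1$.) -/

import Mathlib

universe u v w

/-- A `G`-graded twisted algebra over a field `K` (the group `G` is written additively): a unital,
not necessarily associative `K`-algebra `W = ⨁ g, W_g` with one-dimensional components,
`W_a W_b ⊆ W_{a+b}`, `1 ∈ W_0`, in which products of nonzero homogeneous elements are nonzero. -/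
structure GradedTwistedAlgebra (G : Type w) [AddGroup G] [DecidableEq G]
    (K : Type v) [Field K] where
  carrier : Type u
  [ring : NonAssocRing carrier]
  [module : Module K carrier]
  [isScalarTower : IsScalarTower K carrier carrier]
  [smulCommClass : SMulCommClass K carrier carrier]
  component : G → Submodule K carrier
  isInternal : DirectSum.IsInternal component
  finrank_component : ∀ g, Module.finrank K (component g) = 1
  mul_mem : ∀ {a b : G} {x y : carrier},
    x ∈ component a → y ∈ component b → x * y ∈ component (a + b)
  one_mem : (1 : carrier) ∈ component 0
  mul_ne_zero : ∀ {a b : G} {x y : carrier},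
    x ∈ component a → y ∈ component b → x ≠ 0 → y ≠ 0 → x * y ≠ 0

namespace GradedTwistedAlgebra

attribute [instance] ring module isScalarTower smulCommClass

variable {G : Type w} [AddGroup G] [DecidableEq G] {K : Type v} [Field K]

/-- A graded basis: the choice of a nonzero element of each component. -/
structure GradedBasis (W : GradedTwistedAlgebra.{u} G K) where
  vec : G → W.carrier
  vec_mem : ∀ g, vec g ∈ W.component g
  vec_ne_zero : ∀ g, vec g ≠ 0

namespace GradedBasis

variable {W : GradedTwistedAlgebra.{u} G K} (B : W.GradedBasis)

theorem exists_structureConstant (a b : G) :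
    ∃ c : Kˣ, B.vec a * B.vec b = (c : K) • B.vec (a + b) := by
  obtain ⟨c, hc⟩ := (finrank_eq_one_iff_of_nonzero'
    (⟨B.vec (a + b), B.vec_mem _⟩ : W.component (a + b))
    (fun h => B.vec_ne_zero (a + b) (congrArg Subtype.val h))).1 (W.finrank_component (a + b))
    ⟨B.vec a * B.vec b, W.mul_mem (B.vec_mem a) (B.vec_mem b)⟩
  have hc' : c • B.vec (a + b) = B.vec a * B.vec b := congrArg Subtype.val hc
  have h0 : c ≠ 0 := by
    rintro rfl
    rw [zero_smul] at hc'
    exact W.mul_ne_zero (B.vec_mem a) (B.vec_mem b) (B.vec_ne_zero a) (B.vec_ne_zero b) hc'.symm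
  exact ⟨Units.mk0 c h0, hc'.symm⟩

/-- The structure constant `C : G × G → Kˣ` of a graded basis,
determined by `w_a * w_b = C a b • w_{a+b}`. -/
noncomputable def structureConstant (a b : G) : Kˣ :=
  (B.exists_structureConstant a b).choose

theorem vec_mul_vec (a b : G) :
    B.vec a * B.vec b = (B.structureConstant a b : K) • B.vec (a + b) :=
  (B.exists_structureConstant a b).choose_spec

theorem structureConstant_unique {a b : G} {c : Kˣ}
    (h : B.vec a * B.vec b = (c : K) • B.vec (a + b)) : B.structureConstant a b = c := by
  rw [B.vec_mul_vec] at h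
  exact Units.ext (smul_left_injective K (B.vec_ne_zero (a + b)) h)

/-- `r(a,b,c) = C(b,c) C(ab,c)⁻¹ C(a,bc) C(a,b)⁻¹`. -/
noncomputable def assocFun (a b c : G) : Kˣ :=
  B.structureConstant b c * (B.structureConstant (a + b) c)⁻¹ *
    B.structureConstant a (b + c) * (B.structureConstant a b)⁻¹

end GradedBasis

/-- `W` is `(1,2)`-symmetric if `r(a,b,c) = r(b,a,c)` for all `a, b, c`
(the function `r` does not depend on the graded basis). -/
def IsOneTwoSymmetric (W : GradedTwistedAlgebra.{u} G K) : Prop :=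
  ∀ (B : W.GradedBasis) (a b c : G), B.assocFun a b c = B.assocFun b a c

/-- The structure constants of `W` relative to some graded basis all lie in `A`. -/
def HasStructureConstantsIn (W : GradedTwistedAlgebra.{u} G K) (A : Subgroup Kˣ) : Prop :=
  ∃ B : W.GradedBasis, ∀ a b : G, B.structureConstant a b ∈ A

/-- A graded morphism: a unital homomorphism of `K`-algebras that preserves the grading. -/
structure GradedHom (W V : GradedTwistedAlgebra.{u} G K) extends
    W.carrier →ₗ[K] V.carrier where
  map_one : toFun 1 = 1
  map_mul : ∀ x y, toFun (x * y) = toFun x * toFun y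
  map_mem : ∀ g, ∀ x ∈ W.component g, toFun x ∈ V.component g

namespace GradedHom

def id (W : GradedTwistedAlgebra.{u} G K) : GradedHom W W where
  toLinearMap := LinearMap.id
  map_one := rfl
  map_mul _ _ := rfl
  map_mem _ _ h := h

def comp {W V U : GradedTwistedAlgebra.{u} G K} (ψ : GradedHom V U) (φ : GradedHom W V) :
    GradedHom W U where
  toLinearMap := ψ.toLinearMap.comp φ.toLinearMap
  map_one := (congrArg ψ.toFun φ.map_one).trans ψ.map_one
  map_mul x y := (congrArg ψ.toFun (φ.map_mul x y)).trans (ψ.map_mul _ _)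
  map_mem g x h := ψ.map_mem g _ (φ.map_mem g x h)

end GradedHom

/-- `W` and `V` are graded-isomorphic: there is a graded morphism `W → V` with an inverse that is
a graded morphism. -/
def GradedIsomorphic (W V : GradedTwistedAlgebra.{u} G K) : Prop :=
  ∃ (φ : GradedHom W V) (ψ : GradedHom V W),
    (∀ x, ψ.toFun (φ.toFun x) = x) ∧ ∀ y, φ.toFun (ψ.toFun y) = y

theorem gradedIsomorphic_equivalence :
    Equivalence (GradedIsomorphic : GradedTwistedAlgebra.{u} G K → _ → Prop) where
  refl W := ⟨GradedHom.id W, GradedHom.id W, fun _ => rfl, fun _ => rfl⟩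
  symm := fun ⟨φ, ψ, h₁, h₂⟩ => ⟨ψ, φ, h₂, h₁⟩
  trans := fun ⟨φ, ψ, h₁, h₂⟩ ⟨φ', ψ', h₁', h₂'⟩ =>
    ⟨φ'.comp φ, ψ.comp ψ',
      fun x => (congrArg ψ.toFun (h₁' (φ.toFun x))).trans (h₁ x),
      fun y => (congrArg φ'.toFun (h₂ (ψ'.toFun y))).trans (h₂' y)⟩

/-- Graded isomorphism on the `(1,2)`-symmetric `G`-graded twisted `K`-algebras
with structure constants in `A`. -/
def symmetricSetoid (G : Type w) [AddGroup G] [DecidableEq G] {K : Type v} [Field K]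
    (A : Subgroup Kˣ) :
    Setoid {W : GradedTwistedAlgebra.{u} G K //
      W.IsOneTwoSymmetric ∧ W.HasStructureConstantsIn A} where
  r W V := GradedIsomorphic W.1 V.1
  iseqv :=
    { refl := fun W => gradedIsomorphic_equivalence.refl W.1
      symm := gradedIsomorphic_equivalence.symm
      trans := gradedIsomorphic_equivalence.trans }

/-- The type of graded-isomorphism classes of `(1,2)`-symmetric `G`-graded twisted `K`-algebras
with structure constants in `A`. -/
def SymmetricClasses (G : Type w) [AddGroup G] [DecidableEq G] {K : Type v} [Field K]
    (A : Subgroup Kˣ) : Type (max (u + 1) v w) :=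
  Quotient (symmetricSetoid.{u} G A)

end GradedTwistedAlgebra

/-- `R_m`, the set of `m`-th roots of unity lying in `A`. -/
def rootsIn (A : Subgroup ℂˣ) (m : ℕ) : Set ℂˣ := {ω | ω ∈ A ∧ ω ^ m = 1}

/-! Let `L_a` be left translation by `w_a`. Since `C(a+b,c)` cancels, `(1,2)`-symmetry says exactly
that `L_a` and `L_b` commute up to the scalar `C(a,b)/C(b,a)`. The complete invariant is the family
`Q(g,i) = C(g,e_i)/C(e_i,g)`, with `e_i` the standard generators.

Multiplying the commutation relation of `g` and `e_i` over a cycle in direction `i` shows that `g ↦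
Q(g,i)^{n_i}` is multiplicative (`IsQuasiCommutative.pow_add`). Together with `Q(0,i) = Q(e_i,i) =
1`, antisymmetry on generators and values in `A`, this defines a commutation system.

Both directions of the classification integrate prescribed increments along the generators
(`exists_potential`). If all `Q` are trivial, `C` is a coboundary over a group with roots
(`exists_coboundary`), so over `ℂ` the system `Q` determines the algebra. Conversely every system
occurs (`exists_isQuasiCommutative`): explicit `L_{e_i}` are written down, and each `C(g,·)` is
integrated from the increments that quasi-commutativity forces.

For the count, the values `Q(e_i,j)`, `i < j`, are free `n_i n_j`-th roots of unity in `A`. They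
determine every `Q(g,i)^{n_i}`, so for `g` neither zero nor a generator `Q(g,i)` is free up to an
`n_i`-th root of unity. -/

section ZModPi

set_option linter.unusedSectionVars false

open Finset

/-! ### Cycles and potentials on a product of cyclic groups -/

variable {ι : Type*} [Fintype ι] [DecidableEq ι] {n : ι → ℕ}

/-- The `i`-th standard generator of `∏ i, ZMod (n i)`. -/
def gen (n : ι → ℕ) (i : ι) : (i : ι) → ZMod (n i) := Pi.single i 1

theorem nsmul_gen (i : ι) (m : ℕ) : m • gen n i = Pi.single i (m : ZMod (n i)) := by
  rw [gen, ← Pi.single_smul, nsmul_one]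

theorem card_nsmul_gen (i : ι) : n i • gen n i = 0 := by
  rw [nsmul_gen, ZMod.natCast_self, Pi.single_zero]

theorem gen_induction [∀ i, NeZero (n i)] {p : ((i : ι) → ZMod (n i)) → Prop} (h0 : p 0)
    (hs : ∀ g i, p g → p (g + gen n i)) (g : (i : ι) → ZMod (n i)) : p g := by
  have h1 : ∀ i (m : ℕ) g, p g → p (g + m • gen n i) := by
    intro i m g hg
    induction m with
    | zero => simpa using hg
    | succ m ih => rw [succ_nsmul, ← add_assoc]; exact hs _ _ ih
  have h2 : ∀ s : Finset ι, p (∑ i ∈ s, Pi.single i (g i)) := by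
    intro s
    induction s using Finset.induction_on with
    | empty => simpa using h0
    | insert i s his ih =>
      rw [Finset.sum_insert his, add_comm]
      have := h1 i (g i).val _ ih
      rwa [nsmul_gen, ZMod.natCast_zmod_val] at this
  have := h2 univ
  rwa [Finset.univ_sum_single] at this

variable {M : Type*} [CommGroup M]

/-- Two functions with the same value at `0` and the same increments are equal. -/
theorem eq_of_increments_eq [∀ i, NeZero (n i)] {φ ψ : ((i : ι) → ZMod (n i)) → M}
    (h0 : φ 0 = ψ 0) (h : ∀ c i, φ (c + gen n i) * ψ c = ψ (c + gen n i) * φ c) : φ = ψ := by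
  funext g
  induction g using gen_induction with
  | h0 => exact h0
  | hs g i ih =>
    have := h g i
    rw [ih] at this
    exact mul_right_cancel this

/-- The product of `f` over the cycle through `c` in the `i`-th direction. -/
def cycleProd (i : ι) (f : ((i : ι) → ZMod (n i)) → M) (c : (i : ι) → ZMod (n i)) : M :=
  ∏ s ∈ range (n i), f (c + s • gen n i)

theorem cycleProd_mul (i : ι) (f g : ((i : ι) → ZMod (n i)) → M) (c : (i : ι) → ZMod (n i)) :
    cycleProd i (fun x => f x * g x) c = cycleProd i f c * cycleProd i g c :=
  Finset.prod_mul_distrib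

theorem cycleProd_const (i : ι) (a : M) (c : (i : ι) → ZMod (n i)) :
    cycleProd i (fun _ => a) c = a ^ n i := by
  simp [cycleProd]

theorem cycleProd_shift (i : ι) (f : ((i : ι) → ZMod (n i)) → M) (g c : (i : ι) → ZMod (n i)) :
    cycleProd i (fun x => f (x + g)) c = cycleProd i f (c + g) := by
  simp only [cycleProd, add_right_comm]

theorem cycleProd_add_gen (i : ι) (f : ((i : ι) → ZMod (n i)) → M)
    (c : (i : ι) → ZMod (n i)) : cycleProd i f (c + gen n i) = cycleProd i f c := by
  have h1 : cycleProd i f (c + gen n i) * f c = cycleProd i f c * f (c + n i • gen n i) := by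
    unfold cycleProd
    rw [← Finset.prod_range_succ (fun s : ℕ => f (c + s • gen n i)), Finset.prod_range_succ']
    simp only [zero_nsmul, add_zero, succ_nsmul', add_assoc]
  rw [card_nsmul_gen, add_zero] at h1
  exact mul_right_cancel h1

/-- The fibrewise translation `(c, m) ↦ (c + e_i, h c * m)`. -/
def fibreShift (i : ι) (h : ((i : ι) → ZMod (n i)) → M) :
    Equiv.Perm (((i : ι) → ZMod (n i)) × M) where
  toFun x := (x.1 + gen n i, h x.1 * x.2)
  invFun x := (x.1 - gen n i, (h (x.1 - gen n i))⁻¹ * x.2)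
  left_inv x := by simp
  right_inv x := by simp

theorem fibreShift_pow_apply (i : ι) (h : ((i : ι) → ZMod (n i)) → M) (m : ℕ)
    (x : ((i : ι) → ZMod (n i)) × M) :
    (fibreShift i h ^ m) x =
      (x.1 + m • gen n i, (∏ s ∈ range m, h (x.1 + s • gen n i)) * x.2) := by
  induction m with
  | zero => simp
  | succ m ih =>
    rw [pow_succ', Equiv.Perm.mul_apply, ih, Finset.prod_range_succ]
    simp only [fibreShift, Equiv.coe_fn_mk, succ_nsmul, add_assoc, Prod.mk.injEq, true_and]
    rw [mul_comm _ (h _), mul_assoc]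

/-- A closed system of increments with trivial periods has a potential. -/
theorem exists_potential [∀ i, NeZero (n i)] (h : ι → ((i : ι) → ZMod (n i)) → M)
    (closed : ∀ i j c, h i (c + gen n j) * h j c = h j (c + gen n i) * h i c)
    (period : ∀ i c, cycleProd i (h i) c = 1) :
    ∃ φ : ((i : ι) → ZMod (n i)) → M, φ 0 = 1 ∧ ∀ c i, φ (c + gen n i) = h i c * φ c := by
  -- The shifts commute because the increments are closed, and the `i`-th has order dividing `n i`
  -- because its periods are trivial. They therefore generate an action of the whole group on pairs,
  -- and the orbit of `(0, 1)` is the graph of the potential.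
  let T : ι → Additive (Equiv.Perm (((i : ι) → ZMod (n i)) × M)) :=
    fun i => Additive.ofMul (fibreShift i (h i))
  have hT : ∀ i, n i • T i = 0 := by
    intro i
    refine congrArg Additive.ofMul (Equiv.ext fun x => ?_ :
      fibreShift i (h i) ^ n i = 1)
    have hp := period i x.1
    rw [cycleProd] at hp
    rw [fibreShift_pow_apply, card_nsmul_gen, hp]
    simp
  have hcomm : ∀ i j, AddCommute (T i) (T j) := by
    intro i j
    refine congrArg Additive.ofMul (Equiv.ext fun x => ?_ :
      fibreShift i (h i) * fibreShift j (h j) = fibreShift j (h j) * fibreShift i (h i))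
    simp only [fibreShift, Equiv.Perm.mul_apply, Equiv.coe_fn_mk, ← mul_assoc, closed,
      add_right_comm _ (gen n j)]
  let Θi : ∀ i, ZMod (n i) →+ Additive (Equiv.Perm (((i : ι) → ZMod (n i)) × M)) :=
    fun i => ZMod.lift (n i) ⟨zmultiplesHom _ (T i), by simpa using hT i⟩
  have hΘi : ∀ i (m : ℤ), Θi i m = m • T i := fun i m => by simp [Θi]
  let Θ := AddMonoidHom.noncommPiCoprod Θi (by
    intro i j _ x y
    obtain ⟨a, rfl⟩ := ZMod.intCast_surjective x
    obtain ⟨b, rfl⟩ := ZMod.intCast_surjective y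
    rw [hΘi, hΘi]
    exact ((hcomm i j).zsmul_left a).zsmul_right b)
  have hgen : ∀ i, Θ (gen n i) = T i := by
    intro i
    have h1 := hΘi i 1
    rw [Int.cast_one, one_zsmul] at h1
    rw [gen, ← h1]
    exact AddMonoidHom.noncommPiCoprod_single _ _ _
  have hstep : ∀ g i, (Θ (g + gen n i)).toMul (0, 1) =
      fibreShift i (h i) ((Θ g).toMul (0, 1)) := by
    intro g i
    rw [add_comm, map_add, hgen, toMul_add, Equiv.Perm.mul_apply]
    rfl
  have hfst : ∀ g, ((Θ g).toMul (0, 1)).1 = g := by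
    intro g
    induction g using gen_induction with
    | h0 => simp
    | hs g i ih => rw [hstep]; simp [fibreShift, ih]
  refine ⟨fun g => ((Θ g).toMul (0, 1)).2, by simp, fun c i => ?_⟩
  simp only [hstep]
  simp [fibreShift, hfst]

/-! ### Quasi-commutative functions and their commutation factors -/

/-- A normalized multiplicative two-variable function whose left translations
`C a · ` commute up to scalars. -/
structure IsQuasiCommutative {G : Type*} [AddCommGroup G] (C : G → G → M) : Prop where
  zero_left : ∀ g, C 0 g = 1
  zero_right : ∀ g, C g 0 = 1
  comm : ∀ a b c, C a (b + c) * C b c * C b a = C b (a + c) * C a c * C a b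

namespace IsQuasiCommutative

theorem div {G : Type*} [AddCommGroup G] {C D : G → G → M} (hC : IsQuasiCommutative C)
    (hD : IsQuasiCommutative D) : IsQuasiCommutative fun a b => C a b / D a b where
  zero_left g := by rw [hC.zero_left, hD.zero_left, div_one]
  zero_right g := by rw [hC.zero_right, hD.zero_right, div_one]
  comm a b c := by
    simp only [div_mul_div_comm, hC.comm a b c, hD.comm a b c]

variable {C : ((i : ι) → ZMod (n i)) → ((i : ι) → ZMod (n i)) → M}

/-- Multiply the commutation relation for `g`, `gen n i` and `x` as `x` runs over a cycle: the
products of `C g (x + gen n i)` and of `C g x` are the same and cancel. -/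
theorem cycleProd_mul_pow (hC : IsQuasiCommutative C) (i : ι) (g c : (i : ι) → ZMod (n i)) :
    cycleProd i (C (gen n i)) (c + g) * C g (gen n i) ^ n i =
      cycleProd i (C (gen n i)) c * C (gen n i) g ^ n i := by
  have h : (cycleProd i (fun x => C g (x + gen n i) * C (gen n i) x * C (gen n i) g) c) =
      cycleProd i (fun x => C (gen n i) (x + g) * C g x * C g (gen n i)) c := by
    congr 1
    funext x
    rw [add_comm x, add_comm x]
    exact hC.comm g (gen n i) x
  simp only [cycleProd_mul, cycleProd_const, cycleProd_shift, cycleProd_add_gen] at h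
  rw [mul_right_comm (cycleProd i _ (c + g)), mul_assoc, mul_comm _ (cycleProd i (C g) c)] at h
  exact (mul_left_cancel h).symm

/-- The `n i`-th power of the factor of `g` is a ratio of cycle products at `c` and `c + g`, for any
base point `c`. Taking base point `g` for `h` makes the ratios telescope. -/
theorem pow_add (hC : IsQuasiCommutative C) (i : ι) (g h : (i : ι) → ZMod (n i)) :
    (C (g + h) (gen n i) / C (gen n i) (g + h)) ^ n i =
      (C g (gen n i) / C (gen n i) g) ^ n i * (C h (gen n i) / C (gen n i) h) ^ n i := by
  have key : ∀ g c, (C g (gen n i) / C (gen n i) g) ^ n i =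
      cycleProd i (C (gen n i)) c / cycleProd i (C (gen n i)) (c + g) := by
    intro g c
    rw [div_pow, div_eq_div_iff_mul_eq_mul, mul_comm, hC.cycleProd_mul_pow]
  rw [key (g + h) 0, key g 0, key h (0 + g), div_mul_div_cancel, add_assoc]

/-- Triviality of the commutation factors with the generators forces a coboundary. -/
theorem exists_coboundary [∀ i, NeZero (n i)] (hC : IsQuasiCommutative C)
    (root : ∀ i (a : M), ∃ b, b ^ n i = a)
    (h : ∀ g i, C g (gen n i) = C (gen n i) g) :
    ∃ μ : ((i : ι) → ZMod (n i)) → M, μ 0 = 1 ∧ ∀ a b, C a b * μ a * μ b = μ (a + b) := by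
  have hconst : ∀ i c, cycleProd i (C (gen n i)) c = cycleProd i (C (gen n i)) 0 := by
    intro i c
    have := hC.cycleProd_mul_pow i c 0
    rw [h, zero_add] at this
    exact mul_right_cancel this
  -- Rescaling the translation by the `i`-th generator by `p i` kills its period; this is the only
  -- use of roots.
  choose p hp using fun i => root i (cycleProd i (C (gen n i)) 0)⁻¹
  obtain ⟨μ, hμ0, hμ⟩ := exists_potential (n := n) (fun i c => p i * C (gen n i) c)
    (by
      intro i j c
      have := hC.comm (gen n i) (gen n j) c
      rw [h (gen n j) i] at this
      have := mul_right_cancel this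
      rw [add_comm c, add_comm c, mul_mul_mul_comm, this, mul_comm (p i),
        mul_mul_mul_comm])
    (by
      intro i c
      rw [cycleProd_mul, cycleProd_const, hp, hconst i c, inv_mul_cancel])
  have hμgen : ∀ i, μ (gen n i) = p i := by
    intro i
    have := hμ 0 i
    rwa [zero_add, hC.zero_right, hμ0, mul_one, mul_one] at this
  let D : ((i : ι) → ZMod (n i)) → ((i : ι) → ZMod (n i)) → M :=
    fun a b => C a b / (μ (a + b) / (μ a * μ b))
  have hD : IsQuasiCommutative D := by
    exact hC.div ⟨fun g => by simp [hμ0], fun g => by simp [hμ0], fun a b c => by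
      have e : ∀ x y s t u : M, x / (s * y) * (y / (t * u)) = x / (s * (t * u)) := by
        intro x y s t u
        rw [div_mul_div_comm, div_eq_div_iff_mul_eq_mul]
        simp only [mul_comm, mul_left_comm]
      rw [add_left_comm b a c, add_comm b a, e, e, mul_comm (μ b) (μ a), mul_left_comm (μ b)]⟩
  have hDgen : ∀ i c, D (gen n i) c = 1 := by
    intro i c
    rw [div_eq_one, add_comm, hμ, hμgen, mul_right_comm, mul_comm, mul_div_assoc,
      div_self', mul_one]
  have hDgen' : ∀ i c, D c (gen n i) = 1 := by
    intro i c
    rw [← hDgen i c]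
    simp only [D, h, add_comm, mul_comm]
  -- With both generator arguments trivial, the commutation relation reads `D a (gen n i + b) = D a
  -- b`.
  have hD1 : ∀ a b, D a b = 1 := by
    intro a b
    induction b using gen_induction with
    | h0 => exact hD.zero_right a
    | hs b i ih =>
      have := hD.comm a (gen n i) b
      simp only [hDgen, hDgen', mul_one, ih] at this
      rwa [add_comm]
  refine ⟨μ, hμ0, fun a b => ?_⟩
  have := hD1 a b
  rwa [div_eq_one, eq_div_iff_mul_eq', ← mul_assoc] at this

end IsQuasiCommutative

/-! ### Commutation systems -/

/-- The systems of commutation factors `Q g i` of `g` with the generators `e_i`, with values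
in `A`, that occur in quasi-commutative functions. -/
structure IsCommutationSystem (A : Subgroup M) (Q : ((i : ι) → ZMod (n i)) → ι → M) : Prop where
  mem : ∀ g i, Q g i ∈ A
  zero : ∀ i, Q 0 i = 1
  self : ∀ i, Q (gen n i) i = 1
  antisymm : ∀ i j, Q (gen n i) j * Q (gen n j) i = 1
  pow_add : ∀ g h i, Q (g + h) i ^ n i = Q g i ^ n i * Q h i ^ n i

theorem IsQuasiCommutative.isCommutationSystem
    {C : ((i : ι) → ZMod (n i)) → ((i : ι) → ZMod (n i)) → M}
    (hC : IsQuasiCommutative C) {A : Subgroup M} (hA : ∀ a b, C a b ∈ A) :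
    IsCommutationSystem A fun g i => C g (gen n i) / C (gen n i) g where
  mem _ _ := A.div_mem (hA _ _) (hA _ _)
  zero i := by rw [hC.zero_left, hC.zero_right, div_one]
  self i := div_self' _
  antisymm i j := by rw [div_mul_div_cancel, div_self']
  pow_add g h i := hC.pow_add i g h

namespace IsCommutationSystem

variable {A : Subgroup M} {Q : ((i : ι) → ZMod (n i)) → ι → M}

theorem nsmul_pow (hQ : IsCommutationSystem A Q) (m : ℕ) (g : (i : ι) → ZMod (n i)) (i : ι) :
    Q (m • g) i ^ n i = (Q g i ^ n i) ^ m := by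
  induction m with
  | zero => simp [hQ.zero]
  | succ m ih => rw [succ_nsmul, hQ.pow_add, ih, pow_succ]

/-- `g ↦ Q g j ^ n j` is multiplicative and `n i • gen n i = 0`. -/
theorem gen_pow (hQ : IsCommutationSystem A Q) (i j : ι) :
    Q (gen n i) j ^ (n i * n j) = 1 := by
  rw [mul_comm, pow_mul, ← hQ.nsmul_pow, card_nsmul_gen, hQ.zero, one_pow]

end IsCommutationSystem

theorem ZMod.val_add_one_of_ne {m : ℕ} [NeZero m] {x : ZMod m} (hx : x ≠ -1) :
    (x + 1).val = x.val + 1 := by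
  obtain ⟨m, rfl⟩ := Nat.exists_eq_succ_of_ne_zero (NeZero.ne m)
  have h1 : x.val ≠ m := fun h => hx (ZMod.val_injective _ (h.trans (ZMod.val_neg_one m).symm))
  have h2 := ZMod.val_lt x
  rw [← ZMod.natCast_zmod_val x, ← Nat.cast_succ, ZMod.val_natCast, ZMod.val_natCast,
    Nat.mod_eq_of_lt (by omega), Nat.mod_eq_of_lt (by omega)]

theorem ZMod.val_neg_one_add_one {m : ℕ} [NeZero m] : (-1 : ZMod m).val + 1 = m := by
  obtain ⟨m, rfl⟩ := Nat.exists_eq_succ_of_ne_zero (NeZero.ne m)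
  rw [ZMod.val_neg_one]

/-! ### Model translations with prescribed commutation factors -/

section Increment

variable [LinearOrder ι]

/-- The contribution of the `l`-th coordinate to `stdIncrement`. -/
def stdFactor (q : ι → ι → M) (i l : ι) (c : (i : ι) → ZMod (n i)) : M :=
  if l < i then q i l ^ (c l).val
  else if i < l ∧ c i = -1 then q i l ^ (n i * (c l).val) else 1

/-- Left translations by the generators with prescribed commutation factors `q i j`. -/
def stdIncrement (q : ι → ι → M) (i : ι) (c : (i : ι) → ZMod (n i)) : M :=
  ∏ l, stdFactor q i l c

variable {q : ι → ι → M}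

theorem stdFactor_mem {A : Subgroup M} (hq : ∀ i j, q i j ∈ A) (i l : ι)
    (c : (i : ι) → ZMod (n i)) : stdFactor q i l c ∈ A := by
  unfold stdFactor
  split_ifs
  exacts [A.pow_mem (hq _ _) _, A.pow_mem (hq _ _) _, A.one_mem]

theorem stdIncrement_mem {A : Subgroup M} (hq : ∀ i j, q i j ∈ A) (i : ι)
    (c : (i : ι) → ZMod (n i)) : stdIncrement q i c ∈ A :=
  A.prod_mem fun l _ => stdFactor_mem hq i l c

theorem stdIncrement_zero (i : ι) : stdIncrement q i (0 : (i : ι) → ZMod (n i)) = 1 := by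
  refine Finset.prod_eq_one fun l _ => ?_
  simp [stdFactor]

theorem stdIncrement_add_gen {i j : ι} (hij : i ≠ j) (c : (i : ι) → ZMod (n i)) :
    stdIncrement q i (c + gen n j) * stdFactor q i j c =
      stdIncrement q i c * stdFactor q i j (c + gen n j) := by
  unfold stdIncrement
  rw [← Finset.mul_prod_erase _ _ (mem_univ j),
    ← Finset.mul_prod_erase univ (fun l => stdFactor q i l c) (mem_univ j),
    mul_right_comm, mul_right_comm (stdFactor q i j c), mul_comm (stdFactor q i j c)]
  congr 1
  refine Finset.prod_congr rfl fun l hl => ?_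
  have hl := ne_of_mem_erase hl
  simp [stdFactor, gen, hl, hij]

/-- The power `q i j ^ (c j).val` gains a factor `q i j` at each step in direction `j`, except at
the wrap-around `c j = -1`, where `q i j ^ n j` is lost. The correction in `stdFactor q j i` at `c j
= -1` restores it; when `c i` also wraps around, this is consistent because `q i j ^ (n i * n j) =
1`. -/
theorem stdFactor_comm [∀ i, NeZero (n i)] (hanti : ∀ i j, q i j * q j i = 1)
    (hpow : ∀ i j, q i j ^ (n i * n j) = 1) {i j : ι} (hij : j < i)
    (c : (i : ι) → ZMod (n i)) :
    stdFactor q i j (c + gen n j) * stdFactor q j i c =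
      q i j * (stdFactor q j i (c + gen n i) * stdFactor q i j c) := by
  have hq : q j i = (q i j)⁻¹ := eq_inv_of_mul_eq_one_right (hanti i j)
  simp only [stdFactor, hij, hij.not_gt, if_true, if_false, true_and, Pi.add_apply, gen,
    Pi.single_eq_same, Pi.single_eq_of_ne hij.ne, add_zero]
  by_cases hcj : c j = -1
  · have h1 : q i j * q i j ^ (c j).val = q i j ^ n j := by
      rw [← pow_succ', hcj, ZMod.val_neg_one_add_one]
    simp only [hcj, if_true, neg_add_cancel, ZMod.val_zero, pow_zero, one_mul] at h1 ⊢
    rw [mul_left_comm, h1, hq, inv_pow, inv_pow, inv_mul_eq_div, eq_div_iff_mul_eq',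
      inv_mul_eq_iff_eq_mul, ← pow_add]
    by_cases hci : c i = -1
    · have h2 := ZMod.val_neg_one_add_one (m := n i)
      rw [hci, neg_add_cancel, ZMod.val_zero, mul_zero, pow_zero, ← Nat.mul_add_one, h2,
        mul_comm, hpow]
    · rw [ZMod.val_add_one_of_ne hci, mul_add, mul_one]
  · simp only [hcj, if_false, mul_one, one_mul, ZMod.val_add_one_of_ne hcj, pow_succ']

theorem stdIncrement_comm [∀ i, NeZero (n i)] (hself : ∀ i, q i i = 1)
    (hanti : ∀ i j, q i j * q j i = 1)
    (hpow : ∀ i j, q i j ^ (n i * n j) = 1) (i j : ι) (c : (i : ι) → ZMod (n i)) :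
    stdIncrement q i (c + gen n j) * stdIncrement q j c =
      q i j * (stdIncrement q j (c + gen n i) * stdIncrement q i c) := by
  have hlt : ∀ i j, j < i → stdIncrement q i (c + gen n j) * stdIncrement q j c =
      q i j * (stdIncrement q j (c + gen n i) * stdIncrement q i c) := by
    intro i j hij
    have h1 := stdIncrement_add_gen (q := q) hij.ne' c
    have h2 := stdIncrement_add_gen (q := q) hij.ne c
    have h3 := stdFactor_comm hanti hpow hij c
    refine mul_right_cancel (b := stdFactor q i j c * stdFactor q j i (c + gen n i)) ?_
    calc _ = stdIncrement q i (c + gen n j) * stdFactor q i j c *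
          (stdIncrement q j c * stdFactor q j i (c + gen n i)) := mul_mul_mul_comm _ _ _ _
      _ = stdIncrement q i c * stdIncrement q j (c + gen n i) *
          (stdFactor q i j (c + gen n j) * stdFactor q j i c) := by
        rw [h1, ← h2, mul_mul_mul_comm]
      _ = _ := by
        rw [h3, mul_left_comm, ← mul_assoc, mul_comm (stdIncrement q i c),
          mul_comm (stdFactor q j i _)]
  rcases lt_trichotomy i j with h | rfl | h
  · rw [hlt j i h, ← mul_assoc, hanti, one_mul]
  · rw [hself, one_mul]
  · exact hlt i j h

end Increment

/-- Every commutation system comes from a quasi-commutative function. -/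
theorem IsCommutationSystem.exists_isQuasiCommutative [LinearOrder ι] [∀ i, NeZero (n i)]
    {A : Subgroup M} {Q : ((i : ι) → ZMod (n i)) → ι → M} (hQ : IsCommutationSystem A Q) :
    ∃ C : ((i : ι) → ZMod (n i)) → ((i : ι) → ZMod (n i)) → M,
      IsQuasiCommutative C ∧ (∀ a b, C a b ∈ A) ∧
        ∀ g i, C g (gen n i) / C (gen n i) g = Q g i := by
  let q : ι → ι → M := fun i j => Q (gen n i) j
  have hcomm : ∀ i j (c : (i : ι) → ZMod (n i)), stdIncrement q i (c + gen n j) *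
      stdIncrement q j c = q i j * (stdIncrement q j (c + gen n i) * stdIncrement q i c) :=
    stdIncrement_comm hQ.self hQ.antisymm hQ.gen_pow
  have hmem : ∀ i (c : (i : ι) → ZMod (n i)), stdIncrement q i c ∈ A := stdIncrement_mem fun i j => hQ.mem _ _
  have hcyc : ∀ i c g, Q g i ^ n i * cycleProd i (stdIncrement q i) (c + g) =
      cycleProd i (stdIncrement q i) c := by
    intro i c g
    induction g using gen_induction with
    | h0 => simp [hQ.zero]
    | hs g j ih =>
      have h := congrArg (cycleProd i · (c + g)) (funext (hcomm i j))
      simp only [cycleProd_mul, cycleProd_const, cycleProd_shift, cycleProd_add_gen] at h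
      rw [mul_left_comm, mul_comm] at h
      have h := mul_left_cancel h
      have ha : Q (gen n j) i ^ n i * q i j ^ n i = 1 := by
        rw [← mul_pow, hQ.antisymm, one_pow]
      rw [hQ.pow_add, ← add_assoc, h, ← ih, mul_assoc, ← mul_assoc (Q (gen n j) i ^ n i), ha,
        one_mul]
  -- These increments are forced by the commutation relation of `g` with `gen n i`. They are closed
  -- because the factors `q i j` cancel, and their periods are trivial by `hcyc`.
  have hpot : ∀ g, ∃ φ : ((i : ι) → ZMod (n i)) → M, φ 0 = 1 ∧ ∀ c i, φ (c + gen n i) =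
      Q g i * (stdIncrement q i (c + g) / stdIncrement q i c) * φ c := by
    intro g
    refine exists_potential
      (fun i c => Q g i * (stdIncrement q i (c + g) / stdIncrement q i c)) ?_ ?_
    · intro i j c
      have h1 := hcomm i j (c + g)
      have h2 := hcomm i j c
      rw [mul_mul_mul_comm, mul_mul_mul_comm (Q g j), mul_comm (Q g j), div_mul_div_comm,
        div_mul_div_comm, add_right_comm, h1, h2, add_right_comm, mul_div_mul_left_eq_div]
    · intro i c
      have h := cycleProd_mul i (fun x => Q g i * (stdIncrement q i (x + g) / stdIncrement q i x))
        (stdIncrement q i) c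
      simp only [mul_assoc, div_mul_cancel] at h
      rw [cycleProd_mul i (fun _ => Q g i) (fun x => stdIncrement q i (x + g)), cycleProd_const,
        cycleProd_shift, hcyc] at h
      exact right_eq_mul.mp h
  choose C hC0 hC using hpot
  have hgen : ∀ i, C (gen n i) = stdIncrement q i := by
    intro i
    refine eq_of_increments_eq ((hC0 _).trans (stdIncrement_zero i).symm) fun c j => ?_
    have hij : Q (gen n i) j = q i j := rfl
    rw [hC, mul_right_comm, hij]
    congr 1
    rw [mul_assoc, div_mul_eq_mul_div, mul_div_assoc', ← hcomm, mul_div_assoc, div_self',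
      mul_one]
  refine ⟨C, ⟨fun g => ?_, hC0, fun a b c => ?_⟩, fun a b => ?_, fun g i => ?_⟩
  · induction g using gen_induction with
    | h0 => exact hC0 0
    | hs g i ih => rw [hC, ih, hQ.zero, add_zero, div_self', one_mul, one_mul]
  -- As `c` moves by `gen n i`, both sides are multiplied by `Q a i * Q b i` times the ratio of
  -- `stdIncrement q i` at `a + b + c` and at `c`.
  · have h : ∀ c, C a (b + c) * C b c * C b a = C b (a + c) * C a c * C a b := by
      intro c
      induction c using gen_induction with
      | h0 => rw [add_zero, add_zero, hC0, hC0, mul_one, mul_one, mul_comm]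
      | hs c i ih =>
        rw [← add_assoc, ← add_assoc, hC, hC, hC, hC, mul_mul_mul_comm, mul_assoc, ih,
          mul_mul_mul_comm (Q b i * _), mul_assoc _ (C b (a + c) * _)]
        congr 1
        rw [add_comm b c, add_comm a c, add_right_comm c b a, mul_mul_mul_comm,
          mul_mul_mul_comm (Q b i), mul_comm (Q b i), div_mul_div_cancel, div_mul_div_cancel]
    exact h c
  · induction b using gen_induction with
    | h0 => rw [hC0]; exact A.one_mem
    | hs b i ih =>
      rw [hC]
      exact A.mul_mem (A.mul_mem (hQ.mem _ _) (A.div_mem (hmem _ _) (hmem _ _))) ih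
  · have := hC g 0 i
    rw [zero_add, zero_add, hC0, mul_one, stdIncrement_zero, div_one] at this
    rw [hgen, this, mul_div_assoc, div_self', mul_one]

end ZModPi

/-! ### Graded bases and isomorphism invariants -/

namespace GradedTwistedAlgebra

variable {G : Type w} [AddCommGroup G] [DecidableEq G] {K : Type v} [Field K]

namespace GradedBasis

variable {W : GradedTwistedAlgebra.{u} G K} (B : W.GradedBasis)

theorem component_eq_span (g : G) : W.component g = Submodule.span K {B.vec g} := by
  refine le_antisymm (fun x hx => ?_) ?_
  · obtain ⟨c, hc⟩ := (finrank_eq_one_iff_of_nonzero' (⟨B.vec g, B.vec_mem g⟩ : W.component g)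
      (fun h => B.vec_ne_zero g (congrArg Subtype.val h))).1 (W.finrank_component g) ⟨x, hx⟩
    exact Submodule.mem_span_singleton.2 ⟨c, congrArg Subtype.val hc⟩
  · rw [Submodule.span_singleton_le_iff_mem]
    exact B.vec_mem g

theorem exists_smul_eq {g : G} {x : W.carrier} (hx : x ∈ W.component g) :
    ∃ c : K, x = c • B.vec g := by
  rw [B.component_eq_span, Submodule.mem_span_singleton] at hx
  obtain ⟨c, hc⟩ := hx
  exact ⟨c, hc.symm⟩

/-- The basis of the underlying vector space given by a graded basis. -/
noncomputable def toBasis : Module.Basis G K W.carrier :=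
  Module.Basis.mk (v := B.vec)
    (W.isInternal.submodule_iSupIndep.linearIndependent _ B.vec_mem B.vec_ne_zero)
    (by
      rw [← W.isInternal.submodule_iSup_eq_top, iSup_le_iff]
      intro g
      rw [B.component_eq_span]
      exact Submodule.span_mono (Set.singleton_subset_iff.2 ⟨g, rfl⟩))

@[simp]
theorem toBasis_apply (g : G) : B.toBasis g = B.vec g := by simp [toBasis]

/-- The graded basis obtained by rescaling. -/
def rescale (l : G → Kˣ) : W.GradedBasis where
  vec g := (l g : K) • B.vec g
  vec_mem g := (W.component g).smul_mem _ (B.vec_mem g)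
  vec_ne_zero g := smul_ne_zero (l g).ne_zero (B.vec_ne_zero g)

theorem structureConstant_rescale (l : G → Kˣ) (a b : G) :
    (B.rescale l).structureConstant a b = B.structureConstant a b / l (a + b) * l a * l b := by
  refine structureConstant_unique _ ?_
  simp only [rescale]
  rw [smul_mul_smul_comm, B.vec_mul_vec, smul_smul, smul_smul]
  congr 1
  simp only [Units.val_mul, Units.val_div_eq_div_val]
  field_simp

theorem exists_eq_rescale (B' : W.GradedBasis) : ∃ l : G → Kˣ, B' = B.rescale l := by
  choose c hc using fun g => B.exists_smul_eq (B'.vec_mem g)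
  have h0 : ∀ g, c g ≠ 0 := by
    intro g h
    have := hc g
    rw [h, zero_smul] at this
    exact B'.vec_ne_zero g this
  refine ⟨fun g => Units.mk0 (c g) (h0 g), ?_⟩
  cases B'
  simp only [rescale, GradedBasis.mk.injEq]
  exact funext hc

theorem assocFun_rescale (l : G → Kˣ) (a b c : G) :
    (B.rescale l).assocFun a b c = B.assocFun a b c := by
  simp only [assocFun, structureConstant_rescale, add_assoc]
  refine Units.ext ?_
  simp only [Units.val_mul, Units.val_div_eq_div_val, Units.val_inv_eq_inv_val]
  field_simp

theorem assocFun_symm_iff (a b c : G) : B.assocFun a b c = B.assocFun b a c ↔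
    B.structureConstant a (b + c) * B.structureConstant b c * B.structureConstant b a =
      B.structureConstant b (a + c) * B.structureConstant a c * B.structureConstant a b := by
  unfold assocFun
  rw [add_comm b a, Units.ext_iff, Units.ext_iff]
  simp only [Units.val_mul, Units.val_inv_eq_inv_val]
  field_simp

theorem structureConstant_zero_left (hB : B.vec 0 = 1) (g : G) :
    B.structureConstant 0 g = 1 :=
  B.structureConstant_unique (by rw [hB, one_mul, zero_add, Units.val_one, one_smul])

theorem structureConstant_zero_right (hB : B.vec 0 = 1) (g : G) :
    B.structureConstant g 0 = 1 :=
  B.structureConstant_unique (by rw [hB, mul_one, add_zero, Units.val_one, one_smul])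

theorem isQuasiCommutative (hW : W.IsOneTwoSymmetric) (hB : B.vec 0 = 1) :
    IsQuasiCommutative B.structureConstant where
  zero_left := B.structureConstant_zero_left hB
  zero_right := B.structureConstant_zero_right hB
  comm a b c := (B.assocFun_symm_iff a b c).1 (hW B a b c)

end GradedBasis

theorem carrier_one_ne_zero (W : GradedTwistedAlgebra.{u} G K) (B : W.GradedBasis) :
    (1 : W.carrier) ≠ 0 := fun h => B.vec_ne_zero 0 (by rw [← mul_one (B.vec 0), h, mul_zero])

/-- A graded basis with values in `A` can be normalized at the identity. -/
theorem HasStructureConstantsIn.exists_normalized {W : GradedTwistedAlgebra.{u} G K}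
    {A : Subgroup Kˣ} (hW : W.HasStructureConstantsIn A) :
    ∃ B : W.GradedBasis, B.vec 0 = 1 ∧ ∀ a b, B.structureConstant a b ∈ A := by
  obtain ⟨B, hB⟩ := hW
  obtain ⟨c, hc⟩ := B.exists_smul_eq W.one_mem
  have hc0 : c ≠ 0 := by
    rintro rfl
    rw [zero_smul] at hc
    exact W.carrier_one_ne_zero B hc
  -- Since `1 = c • B.vec 0`, the square of `B.vec 0` is `c⁻¹ • B.vec 0`, so `c` is the inverse of a
  -- structure constant.
  have hcA : Units.mk0 c hc0 ∈ A := by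
    have : (B.structureConstant 0 0)⁻¹ = Units.mk0 c hc0 := by
      rw [inv_eq_iff_eq_inv]
      refine B.structureConstant_unique ?_
      rw [add_zero, Units.val_inv_eq_inv_val, Units.val_mk0, eq_inv_smul_iff₀ hc0,
        ← smul_mul_assoc, ← hc, one_mul]
    rw [← this]
    exact A.inv_mem (hB _ _)
  refine ⟨B.rescale fun g => if g = 0 then Units.mk0 c hc0 else 1, ?_, fun a b => ?_⟩
  · simp [GradedBasis.rescale, ← hc]
  · have : ∀ g : G, (if g = 0 then Units.mk0 c hc0 else 1) ∈ A := by
      intro g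
      split_ifs
      exacts [hcA, A.one_mem]
    rw [GradedBasis.structureConstant_rescale]
    exact A.mul_mem (A.mul_mem (A.div_mem (hB _ _) (this _)) (this _)) (this _)

/-- Algebras with normalized graded bases with the same structure constants admit a graded
morphism matching the bases. -/
theorem exists_gradedHom {W V : GradedTwistedAlgebra.{u} G K} (B : W.GradedBasis)
    (D : V.GradedBasis) (hB : B.vec 0 = 1) (hD : D.vec 0 = 1)
    (h : ∀ a b, B.structureConstant a b = D.structureConstant a b) :
    ∃ φ : GradedHom W V, ∀ g, φ.toLinearMap (B.vec g) = D.vec g := by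
  let f : W.carrier →ₗ[K] V.carrier := B.toBasis.constr K D.vec
  have hf : ∀ g, f (B.vec g) = D.vec g := by
    intro g
    rw [← B.toBasis_apply]
    exact B.toBasis.constr_basis _ _ _
  have hmul : (LinearMap.mul K W.carrier).compr₂ f = (LinearMap.mul K V.carrier).compl₁₂ f f := by
    refine B.toBasis.ext fun a => B.toBasis.ext fun b => ?_
    simp [hf, B.vec_mul_vec, D.vec_mul_vec, h]
  refine ⟨⟨f, ?_, fun x y => LinearMap.congr_fun₂ hmul x y, fun g x hx => ?_⟩, hf⟩
  · rw [← hB, ← hD]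
    exact hf 0
  · obtain ⟨c, rfl⟩ := B.exists_smul_eq hx
    show f _ ∈ _
    rw [map_smul, hf]
    exact (V.component g).smul_mem _ (D.vec_mem g)

theorem gradedIsomorphic_of_structureConstant_eq {W V : GradedTwistedAlgebra.{u} G K}
    (B : W.GradedBasis) (D : V.GradedBasis) (hB : B.vec 0 = 1) (hD : D.vec 0 = 1)
    (h : ∀ a b, B.structureConstant a b = D.structureConstant a b) :
    GradedIsomorphic W V := by
  obtain ⟨φ, hφ⟩ := exists_gradedHom B D hB hD h
  obtain ⟨ψ, hψ⟩ := exists_gradedHom D B hD hB fun a b => (h a b).symm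
  refine ⟨φ, ψ, LinearMap.congr_fun (f := ψ.toLinearMap ∘ₗ φ.toLinearMap) (g := LinearMap.id)
      (B.toBasis.ext fun g => ?_),
    LinearMap.congr_fun (f := φ.toLinearMap ∘ₗ ψ.toLinearMap) (g := LinearMap.id)
      (D.toBasis.ext fun g => ?_)⟩
  · simp [hφ, hψ]
  · simp [hφ, hψ]

/-- The ratio `C(a,b) / C(b,a)`, which does not depend on the graded basis. -/
noncomputable def GradedBasis.commFactor {W : GradedTwistedAlgebra.{u} G K} (B : W.GradedBasis)
    (a b : G) : Kˣ :=
  B.structureConstant a b / B.structureConstant b a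

theorem GradedBasis.commFactor_eq_iff {W : GradedTwistedAlgebra.{u} G K} (B : W.GradedBasis)
    (a b : G) (c : Kˣ) : B.commFactor a b = c ↔
      B.vec a * B.vec b = (c : K) • (B.vec b * B.vec a) := by
  rw [B.vec_mul_vec, B.vec_mul_vec, smul_smul, add_comm b a, commFactor, div_eq_iff_eq_mul]
  refine ⟨fun h => by rw [h, Units.val_mul], fun h => ?_⟩
  exact Units.ext ((smul_left_injective K (B.vec_ne_zero (a + b)) h).trans
    (Units.val_mul _ _).symm)

/-- An isomorphism carries one graded basis to a rescaling of the other, and rescaling multiplies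
`C(a,b)` and `C(b,a)` by the same scalar. -/
theorem GradedIsomorphic.commFactor_eq {W V : GradedTwistedAlgebra.{u} G K}
    (h : GradedIsomorphic W V) (B : W.GradedBasis) (D : V.GradedBasis) (a b : G) :
    B.commFactor a b = D.commFactor a b := by
  obtain ⟨φ, ψ, h1, h2⟩ := h
  have hmem : ∀ g, φ.toLinearMap (B.vec g) ∈ V.component g := fun g => φ.map_mem g _ (B.vec_mem g)
  have hne : ∀ g, φ.toLinearMap (B.vec g) ≠ 0 := by
    intro g hg
    have := h1 (B.vec g)
    rw [show φ.toFun (B.vec g) = 0 from hg] at this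
    exact B.vec_ne_zero g (this.symm.trans (map_zero ψ.toLinearMap))
  obtain ⟨l, hl⟩ := D.exists_eq_rescale ⟨_, hmem, hne⟩
  have h3 := (B.commFactor_eq_iff a b _).1 rfl
  have h4 := congrArg φ.toLinearMap h3
  rw [map_smul] at h4
  have h5 : (D.rescale l).commFactor a b = B.commFactor a b := by
    rw [GradedBasis.commFactor_eq_iff, ← hl]
    refine (φ.map_mul _ _).symm.trans (h4.trans (congrArg _ (φ.map_mul _ _)))
  rw [← h5]
  simp only [GradedBasis.commFactor, GradedBasis.structureConstant_rescale]
  rw [add_comm b a, mul_right_comm _ (l b), mul_div_mul_right_eq_div, mul_div_mul_right_eq_div,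
    div_div_div_cancel_right]

/-- Over an algebraically closed field, `(1,2)`-symmetric algebras with the same commutation
factors with the generators are isomorphic. -/
theorem gradedIsomorphic_of_commFactor_eq {ι : Type*} [Fintype ι] [DecidableEq ι] {n : ι → ℕ}
    [∀ i, NeZero (n i)] [DecidableEq ((i : ι) → ZMod (n i))] [IsAlgClosed K]
    {W V : GradedTwistedAlgebra.{u} ((i : ι) → ZMod (n i)) K}
    (hW : W.IsOneTwoSymmetric) (hV : V.IsOneTwoSymmetric)
    (B : W.GradedBasis) (D : V.GradedBasis) (hB : B.vec 0 = 1) (hD : D.vec 0 = 1)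
    (h : ∀ g i, B.commFactor g (gen n i) = D.commFactor g (gen n i)) :
    GradedIsomorphic W V := by
  obtain ⟨μ, hμ0, hμ⟩ := ((B.isQuasiCommutative hW hB).div
    (D.isQuasiCommutative hV hD)).exists_coboundary
    (by
      -- The roots may lie outside `A`. This is harmless: an isomorphism may rescale by arbitrary
      -- units.
      intro i a
      obtain ⟨z, hz⟩ := IsAlgClosed.exists_pow_nat_eq (a : K) (NeZero.pos (n i))
      have hz0 : z ≠ 0 := by
        rintro rfl
        rw [zero_pow (NeZero.ne _)] at hz
        exact a.ne_zero hz.symm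
      exact ⟨Units.mk0 z hz0, Units.ext hz⟩)
    (by
      intro g i
      have := h g i
      rw [GradedBasis.commFactor, GradedBasis.commFactor, div_eq_div_iff_mul_eq_mul] at this
      rw [div_eq_div_iff_mul_eq_mul, this, mul_comm])
  refine gradedIsomorphic_of_structureConstant_eq (B.rescale μ) D ?_ hD fun a b => ?_
  · simp [GradedBasis.rescale, hμ0, hB]
  · rw [GradedBasis.structureConstant_rescale, ← hμ a b]
    refine Units.ext ?_
    simp only [Units.val_mul, Units.val_div_eq_div_val]
    field_simp

/-! ### The algebra with given structure constants -/

section OfStructureConstant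

/-- The underlying space of the algebra with given structure constants. -/
def TwistedCarrier {G : Type w} {K : Type v} [Field K] (_ : G → G → K) : Type (max u v w) :=
  ULift.{u} (G →₀ K)

variable {G : Type w} {K : Type v} [Field K] (C : G → G → K)

noncomputable instance : AddCommGroup (TwistedCarrier.{u} C) :=
  inferInstanceAs (AddCommGroup (ULift.{u} (G →₀ K)))

noncomputable instance : Module K (TwistedCarrier.{u} C) :=
  inferInstanceAs (Module K (ULift.{u} (G →₀ K)))

/-- The standard basis of the algebra with given structure constants. -/
noncomputable def twistedBasis : Module.Basis G K (TwistedCarrier.{u} C) :=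
  Module.Basis.ofRepr (ULift.moduleEquiv : ULift.{u} (G →₀ K) ≃ₗ[K] (G →₀ K))

variable [AddCommGroup G]

/-- The multiplication of the algebra with given structure constants. -/
noncomputable def twistedMul :
    TwistedCarrier.{u} C →ₗ[K] TwistedCarrier.{u} C →ₗ[K] TwistedCarrier.{u} C :=
  (twistedBasis C).constr K fun a => (twistedBasis C).constr K fun b =>
    C a b • twistedBasis C (a + b)

theorem twistedMul_basis (a b : G) : twistedMul.{u} C (twistedBasis C a) (twistedBasis C b) =
    C a b • twistedBasis C (a + b) := by
  rw [twistedMul, Module.Basis.constr_basis, Module.Basis.constr_basis]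

/-- The twisted algebra with given normalized structure constants. -/
noncomputable def ofStructureConstant [DecidableEq G] (C : G → G → Kˣ)
    (hl : ∀ g, C 0 g = 1) (hr : ∀ g, C g 0 = 1) :
    GradedTwistedAlgebra.{max u v w} G K :=
  let C' : G → G → K := fun a b => C a b
  have hmul : ∀ {a b : G} {x y : TwistedCarrier.{u} C'},
      x ∈ Submodule.span K {twistedBasis C' a} → y ∈ Submodule.span K {twistedBasis C' b} →
      ∃ c d : K, x = c • twistedBasis C' a ∧ y = d • twistedBasis C' b ∧
        twistedMul C' x y = (c * d * C a b) • twistedBasis C' (a + b) := by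
    intro a b x y hx hy
    obtain ⟨c, rfl⟩ := Submodule.mem_span_singleton.1 hx
    obtain ⟨d, rfl⟩ := Submodule.mem_span_singleton.1 hy
    refine ⟨c, d, rfl, rfl, ?_⟩
    rw [map_smul, map_smul, LinearMap.smul_apply, twistedMul_basis, smul_smul, smul_smul,
      mul_comm d, mul_assoc]
  letI : NonAssocRing (TwistedCarrier.{u} C') :=
    { (inferInstance : AddCommGroup (TwistedCarrier.{u} C')) with
      mul := fun x y => twistedMul C' x y
      one := twistedBasis C' 0
      left_distrib := fun x y z => map_add (twistedMul C' x) y z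
      right_distrib := fun x y z => LinearMap.map_add₂ (twistedMul C') x y z
      zero_mul := fun x => LinearMap.map_zero₂ (twistedMul C') x
      mul_zero := fun x => map_zero (twistedMul C' x)
      one_mul := fun x => LinearMap.congr_fun (f := twistedMul C' (twistedBasis C' 0))
        (g := LinearMap.id) ((twistedBasis C').ext fun a => by
          simp [twistedMul_basis, C', hl]) x
      mul_one := fun x => LinearMap.congr_fun (f := (twistedMul C').flip (twistedBasis C' 0))
        (g := LinearMap.id) ((twistedBasis C').ext fun a => by
          simp [twistedMul_basis, C', hr]) x }
  { carrier := TwistedCarrier.{u} C'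
    isScalarTower := ⟨fun c x y => LinearMap.map_smul₂ (twistedMul C') c x y⟩
    smulCommClass := ⟨fun c x y => (map_smul (twistedMul C' x) c y).symm⟩
    component := fun g => Submodule.span K {twistedBasis C' g}
    isInternal := by
      refine (DirectSum.isInternal_submodule_iff_iSupIndep_and_iSup_eq_top _).2
        ⟨(twistedBasis C').linearIndependent.iSupIndep_span_singleton, ?_⟩
      rw [← Submodule.span_range_eq_iSup, (twistedBasis C').span_eq]
    finrank_component := fun g => finrank_span_singleton ((twistedBasis C').ne_zero g)
    mul_mem := by
      intro a b x y hx hy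
      obtain ⟨c, d, -, -, h⟩ := hmul hx hy
      exact Submodule.mem_span_singleton.2 ⟨_, h.symm⟩
    one_mem := Submodule.mem_span_singleton_self _
    mul_ne_zero := by
      intro a b x y hx hy hx0 hy0
      obtain ⟨c, d, rfl, rfl, h⟩ := hmul hx hy
      have hc : c ≠ 0 := fun h => hx0 (by rw [h, zero_smul])
      have hd : d ≠ 0 := fun h => hy0 (by rw [h, zero_smul])
      intro h0
      exact smul_ne_zero (_root_.mul_ne_zero (_root_.mul_ne_zero hc hd) (C a b).ne_zero)
        ((twistedBasis C').ne_zero (a + b)) (h.symm.trans h0) }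

theorem exists_gradedBasis [DecidableEq G] (C : G → G → Kˣ)
    (hl : ∀ g, C 0 g = 1) (hr : ∀ g, C g 0 = 1) :
    ∃ (W : GradedTwistedAlgebra.{max u v w} G K) (B : W.GradedBasis),
      B.vec 0 = 1 ∧ ∀ a b, B.structureConstant a b = C a b := by
  let C' : G → G → K := fun a b => C a b
  let B : (ofStructureConstant.{u} C hl hr).GradedBasis :=
    { vec := fun g => (twistedBasis C' g : TwistedCarrier.{u} C')
      vec_mem := fun g => Submodule.mem_span_singleton_self (R := K) (twistedBasis.{u} C' g)
      vec_ne_zero := fun g => (twistedBasis C').ne_zero g }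
  exact ⟨_, B, rfl, fun a b => B.structureConstant_unique (twistedMul_basis C' a b)⟩

theorem GradedBasis.isOneTwoSymmetric [DecidableEq G] {W : GradedTwistedAlgebra.{u} G K}
    (B : W.GradedBasis)
    (hB : IsQuasiCommutative B.structureConstant) : W.IsOneTwoSymmetric := by
  intro B' a b c
  obtain ⟨l, rfl⟩ := B.exists_eq_rescale B'
  rw [assocFun_rescale, assocFun_rescale, assocFun_symm_iff]
  exact hB.comm a b c

end OfStructureConstant

end GradedTwistedAlgebra

/-! ### Counting commutation systems -/

section Counting

set_option linter.unusedSectionVars false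

open Finset

/-- Separates out the pairs involving a trivial index (`n i = 1` in the application). Each `r j`
with `j` nontrivial occurs once for every trivial index, before or after `j`; pairs of trivial
indices contribute `1`. -/
theorem prod_pairs_eq {ι N : Type*} [Fintype ι] [LinearOrder ι] [CommMonoid N]
    (t : ι → Prop) [DecidablePred t] (r : ι → N) (s : ι → ι → N) (hr : ∀ i, t i → r i = 1)
    (hs : ∀ i j, t i → s i j = r j) (hs' : ∀ i j, t j → s i j = r i) :
    (∏ i, ∏ j, if i < j then s i j else 1) =
      (∏ i, r i) ^ #{i | t i} * ∏ i, ∏ j, if i < j ∧ ¬ t i ∧ ¬ t j then s i j else 1 := by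
  have h1 : (∏ i, r i) ^ #{i | t i} =
      (∏ i, ∏ j, if i < j ∧ t i then r j else 1) * ∏ i, ∏ j, if i < j ∧ t j then r i else 1 := by
    rw [Finset.prod_comm (f := fun i j => if i < j ∧ t j then r i else 1),
      ← Finset.prod_mul_distrib, ← Finset.prod_const, Finset.prod_filter]
    refine Finset.prod_congr rfl fun i _ => ?_
    rw [← Finset.prod_mul_distrib]
    by_cases hi : t i
    · rw [if_pos hi]
      refine Finset.prod_congr rfl fun j _ => ?_
      rcases lt_trichotomy i j with h | rfl | h
      · simp [h, h.not_gt, hi]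
      · simp [hr i hi]
      · simp [h, h.not_gt, hi]
    · simp [hi]
  rw [h1]
  simp only [← Finset.prod_mul_distrib]
  refine Finset.prod_congr rfl fun i _ => Finset.prod_congr rfl fun j _ => ?_
  by_cases hij : i < j
  · by_cases hi : t i
    · by_cases hj : t j
      · simp [hij, hi, hj, hs i j hi, hr]
      · simp [hij, hi, hj, hs i j hi]
    · by_cases hj : t j
      · simp [hij, hi, hj, hs' i j hj]
      · simp [hij, hi, hj]
  · simp [hij]

variable {ι : Type*} [Fintype ι] [LinearOrder ι] {n : ι → ℕ}

/-- `g` is zero or one of the standard generators. -/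
def IsZeroOrGen (g : (i : ι) → ZMod (n i)) : Prop := g = 0 ∨ ∃ j, g = gen n j

theorem gen_eq_zero {i : ι} (h : n i = 1) : gen n i = 0 := by
  have := card_nsmul_gen (n := n) i
  rwa [h, one_nsmul] at this

/-- Generators of trivial factors coincide with `0`; the others are nonzero and distinct. -/
theorem card_isZeroOrGen [∀ i, NeZero (n i)] :
    Nat.card {g : (i : ι) → ZMod (n i) // IsZeroOrGen g} = #{i | n i ≠ 1} + 1 := by
  classical
  have hne : ∀ i, n i ≠ 1 → (1 : ZMod (n i)) ≠ 0 := by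
    intro i hi h
    have := ZMod.val_one'' hi
    rw [h, ZMod.val_zero] at this
    exact zero_ne_one this
  have hinj : Set.InjOn (gen n) ↑({i | n i ≠ 1} : Finset ι) := by
    intro i hi j _ h
    by_contra hij
    have := congrFun h i
    rw [gen, gen, Pi.single_eq_same, Pi.single_eq_of_ne hij] at this
    exact hne i (by simpa using hi) this
  have h0 : (0 : (i : ι) → ZMod (n i)) ∉ image (gen n) {i | n i ≠ 1} := by
    simp only [mem_image, mem_filter, mem_univ, true_and, not_exists, not_and]
    intro i hi h
    have := congrFun h i
    rw [gen, Pi.single_eq_same] at this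
    exact hne i hi this
  rw [← card_image_of_injOn hinj, ← card_insert_of_notMem h0]
  refine Nat.subtype_card _ fun g => ?_
  simp only [mem_insert, mem_image, mem_filter, mem_univ, true_and, IsZeroOrGen]
  constructor
  · rintro (h | ⟨j, -, hj⟩)
    exacts [Or.inl h, Or.inr ⟨j, hj.symm⟩]
  · rintro (h | ⟨j, rfl⟩)
    · exact Or.inl h
    · by_cases hj : n j = 1
      · exact Or.inl (gen_eq_zero hj)
      · exact Or.inr ⟨j, hj, rfl⟩

/-- The multiplicative extension to standard representatives of values on the generators. -/
def reprProd {M : Type*} [CommGroup M] (q : ι → ι → M) (g : (i : ι) → ZMod (n i)) (i : ι) : M :=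
  ∏ j, q j i ^ (g j).val

section reprProd

variable {M : Type*} [CommGroup M] {q : ι → ι → M}

theorem reprProd_zero (i : ι) : reprProd q (0 : (i : ι) → ZMod (n i)) i = 1 := by
  simp [reprProd]

theorem reprProd_gen (hq : ∀ j i, n j = 1 → q j i = 1) (j i : ι) :
    reprProd q (gen n j) i = q j i := by
  rw [reprProd, Finset.prod_eq_single j]
  · rw [gen, Pi.single_eq_same]
    by_cases hj : n j = 1
    · rw [hq j i hj, one_pow]
    · rw [ZMod.val_one'' hj, pow_one]
  · intro l _ hl
    rw [gen, Pi.single_eq_of_ne hl, ZMod.val_zero, pow_zero]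
  · simp

/-- Reducing a sum of representatives modulo `n j` changes the exponent of `q j i` by a multiple of
`n j`, which the `n i`-th power makes invisible. -/
theorem reprProd_add_pow [∀ i, NeZero (n i)] (hq : ∀ j i, q j i ^ (n j * n i) = 1)
    (g h : (i : ι) → ZMod (n i)) (i : ι) :
    reprProd q (g + h) i ^ n i = reprProd q g i ^ n i * reprProd q h i ^ n i := by
  simp only [reprProd, ← Finset.prod_pow, ← Finset.prod_mul_distrib]
  refine Finset.prod_congr rfl fun j _ => ?_
  rw [← pow_mul, ← pow_mul, ← pow_mul, mul_comm, mul_comm (g j).val, mul_comm (h j).val,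
    pow_mul, pow_mul, pow_mul, ← pow_add, Pi.add_apply, ZMod.val_add]
  refine (pow_eq_pow_mod _ ?_).symm
  rw [← pow_mul, mul_comm, hq]

end reprProd

namespace IsCommutationSystem

variable {M : Type*} [CommGroup M] {A : Subgroup M} {Q : ((i : ι) → ZMod (n i)) → ι → M}

theorem gen_left (hQ : IsCommutationSystem A Q) (j i : ι) (h : n j = 1) : Q (gen n j) i = 1 := by
  rw [gen_eq_zero h, hQ.zero]

theorem gen_right (hQ : IsCommutationSystem A Q) (j i : ι) (h : n i = 1) :
    Q (gen n j) i = 1 := by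
  rw [← hQ.antisymm j i, hQ.gen_left i j h, mul_one]

/-- Both sides are multiplicative in `g` and agree on the generators. Hence `Q g i` deviates from
`reprProd` by an `n i`-th root of unity. -/
theorem pow_eq [∀ i, NeZero (n i)] (hQ : IsCommutationSystem A Q) (g : (i : ι) → ZMod (n i))
    (i : ι) : Q g i ^ n i = reprProd (fun j i => Q (gen n j) i) g i ^ n i := by
  induction g using gen_induction with
  | h0 => rw [hQ.zero, reprProd_zero]
  | hs g j ih =>
    rw [hQ.pow_add, ih, reprProd_add_pow hQ.gen_pow, reprProd_gen hQ.gen_left]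

theorem reprProd_of_isZeroOrGen (hQ : IsCommutationSystem A Q) {g : (i : ι) → ZMod (n i)}
    (hg : IsZeroOrGen g) (i : ι) : reprProd (fun j i => Q (gen n j) i) g i = Q g i := by
  rcases hg with rfl | ⟨j, rfl⟩
  · rw [reprProd_zero, hQ.zero]
  · rw [reprProd_gen hQ.gen_left]

end IsCommutationSystem

theorem isCommutationSystem_mul_reprProd {M : Type*} [CommGroup M] [∀ i, NeZero (n i)]
    {A : Subgroup M} {q : ι → ι → M} (hqA : ∀ i j, q i j ∈ A) (hqself : ∀ i, q i i = 1)
    (hqanti : ∀ i j, q i j * q j i = 1) (hqtriv : ∀ j i, n j = 1 → q j i = 1)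
    (hqpow : ∀ i j, q i j ^ (n i * n j) = 1) {T : ((i : ι) → ZMod (n i)) → ι → M}
    (hTA : ∀ g i, T g i ∈ A) (hTpow : ∀ g i, T g i ^ n i = 1)
    (hT : ∀ g i, IsZeroOrGen g → T g i = 1) :
    IsCommutationSystem A fun g i => T g i * reprProd q g i := by
  have hgen : ∀ j i, T (gen n j) i * reprProd q (gen n j) i = q j i := fun j i => by
    rw [hT _ _ (Or.inr ⟨j, rfl⟩), reprProd_gen hqtriv, one_mul]
  refine ⟨fun g i => ?_, fun i => ?_, fun i => ?_, fun i j => ?_, fun g h i => ?_⟩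
  · exact A.mul_mem (hTA g i) (A.prod_mem fun j _ => A.pow_mem (hqA j i) _)
  · rw [hT _ _ (Or.inl rfl), reprProd_zero, one_mul]
  · rw [hgen, hqself]
  · rw [hgen, hgen, hqanti]
  · rw [mul_pow, mul_pow, mul_pow, hTpow, hTpow, hTpow, one_mul, one_mul, one_mul,
      reprProd_add_pow hqpow]

/-- The possible commutation factors of pairs of generators. -/
def pairRoots (n : ι → ℕ) (A : Subgroup ℂˣ) (i j : ι) : Set ℂˣ :=
  {ω | ω ∈ rootsIn A (n i * n j) ∧ (¬ (i < j ∧ ¬ n i = 1 ∧ ¬ n j = 1) → ω = 1)}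

/-- The possible deviations of a commutation system from `reprProd`. -/
def freeRoots (A : Subgroup ℂˣ) (g : (i : ι) → ZMod (n i)) (i : ι) : Set ℂˣ :=
  {ω | ω ∈ rootsIn A (n i) ∧ (IsZeroOrGen g → ω = 1)}

theorem one_mem_rootsIn (A : Subgroup ℂˣ) (m : ℕ) : 1 ∈ rootsIn A m := ⟨A.one_mem, one_pow m⟩

/-- Commutation systems are parametrized by independent roots of unity. -/
noncomputable def commutationSystemEquiv [∀ i, NeZero (n i)] (A : Subgroup ℂˣ) :
    {Q : ((i : ι) → ZMod (n i)) → ι → ℂˣ // IsCommutationSystem A Q} ≃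
      ((i j : ι) → pairRoots n A i j) × ((g : (i : ι) → ZMod (n i)) → (i : ι) → freeRoots A g i)
    where
  toFun Q := (fun i j => ⟨if i < j then Q.1 (gen n i) j else 1, by
      refine ⟨?_, fun h => ?_⟩
      · split_ifs
        exacts [⟨Q.2.mem _ _, Q.2.gen_pow i j⟩, one_mem_rootsIn A _]
      · split_ifs with hij
        · by_cases hi : n i = 1
          · exact Q.2.gen_left i j hi
          · exact Q.2.gen_right i j (by_contra fun hj => h ⟨hij, hi, hj⟩)
        · rfl⟩,
    fun g i => ⟨Q.1 g i / reprProd (fun j i => Q.1 (gen n j) i) g i,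
      ⟨A.div_mem (Q.2.mem _ _) (A.prod_mem fun j _ => A.pow_mem (Q.2.mem _ _) _), by
        rw [div_pow, ← Q.2.pow_eq, div_self']⟩,
      fun hg => by rw [Q.2.reprProd_of_isZeroOrGen hg, div_self']⟩)
  -- Only the entries of `x.1` above the diagonal can differ from `1`, so `x.1 i j / x.1 j i` is
  -- their antisymmetric extension.
  invFun x := ⟨fun g i => x.2 g i * reprProd (fun i j => (x.1 i j / x.1 j i : ℂˣ)) g i, by
    have htriv : ∀ i j, n i = 1 ∨ n j = 1 → (x.1 i j : ℂˣ) = 1 := fun i j h =>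
      (x.1 i j).2.2 fun h' => h.elim h'.2.1 h'.2.2
    refine isCommutationSystem_mul_reprProd (M := ℂˣ) (T := fun g i => (x.2 g i : ℂˣ))
      (q := fun i j => (x.1 i j / x.1 j i : ℂˣ)) (fun i j => ?_) (fun i => div_self' _)
      (fun i j => ?_) (fun j i h => ?_) (fun i j => ?_) (fun g i => (x.2 g i).2.1.1)
      (fun g i => (x.2 g i).2.1.2) (fun g i => (x.2 g i).2.2)
    · exact A.div_mem (x.1 i j).2.1.1 (x.1 j i).2.1.1
    · rw [div_mul_div_cancel, div_self']
    · rw [htriv j i (Or.inl h), htriv i j (Or.inr h), div_one]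
    · rw [div_pow, (x.1 i j).2.1.2, mul_comm, (x.1 j i).2.1.2, div_one]⟩
  left_inv Q := by
    have hq : (fun i j => (if i < j then Q.1 (gen n i) j else 1) /
        (if j < i then Q.1 (gen n j) i else 1)) = fun i j => Q.1 (gen n i) j := by
      funext i j
      rcases lt_trichotomy i j with h | rfl | h
      · rw [if_pos h, if_neg h.not_gt, div_one]
      · rw [div_self', Q.2.self]
      · rw [if_neg h.not_gt, if_pos h, div_eq_iff_eq_mul, Q.2.antisymm]
    ext g i : 3
    simp only [hq, div_mul_cancel]
  right_inv x := by
    have hgt : ∀ i j, ¬ i < j → (x.1 i j : ℂˣ) = 1 := fun i j h =>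
      (x.1 i j).2.2 fun h' => h h'.1
    have hgen : ∀ i j, (x.2 (gen n i) j * reprProd (fun i j => (x.1 i j / x.1 j i : ℂˣ))
        (gen n i) j : ℂˣ) = x.1 i j / x.1 j i := by
      intro i j
      rw [(x.2 _ j).2.2 (Or.inr ⟨i, rfl⟩), one_mul, reprProd_gen]
      intro i j h
      rw [(x.1 i j).2.2 fun h' => h'.2.1 h, (x.1 j i).2.2 fun h' => h'.2.2 h, div_one]
    simp only [hgen]
    refine Prod.ext ?_ ?_
    · funext i j
      refine Subtype.ext ?_
      show (if i < j then (x.1 i j / x.1 j i : ℂˣ) else 1) = x.1 i j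
      split_ifs with h
      · rw [hgt j i h.not_gt, div_one]
      · exact (hgt i j h).symm
    · funext g i
      exact Subtype.ext (mul_div_cancel_right _ _)

theorem card_pairRoots (A : Subgroup ℂˣ) (i j : ι) : Nat.card (pairRoots n A i j) =
    if i < j ∧ ¬ n i = 1 ∧ ¬ n j = 1 then (rootsIn A (n i * n j)).ncard else 1 := by
  rw [Nat.card_coe_set_eq]
  split_ifs with h
  · congr 1
    ext ω
    exact ⟨fun hω => hω.1, fun hω => ⟨hω, fun h' => absurd h h'⟩⟩
  · rw [Set.ncard_eq_one]
    refine ⟨1, Set.eq_singleton_iff_unique_mem.2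
      ⟨⟨one_mem_rootsIn A _, fun _ => rfl⟩, fun ω hω => hω.2 h⟩⟩

open Classical in
theorem card_freeRoots (A : Subgroup ℂˣ) (g : (i : ι) → ZMod (n i)) (i : ι) :
    Nat.card (freeRoots A g i) = if IsZeroOrGen g then 1 else (rootsIn A (n i)).ncard := by
  rw [Nat.card_coe_set_eq]
  split_ifs with h
  · rw [Set.ncard_eq_one]
    refine ⟨1, Set.eq_singleton_iff_unique_mem.2
      ⟨⟨one_mem_rootsIn A _, fun _ => rfl⟩, fun ω hω => hω.2 h⟩⟩
  · congr 1
    ext ω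
    exact ⟨fun hω => hω.1, fun hω => ⟨hω, fun h' => absurd h' h⟩⟩

theorem rootsIn_one (A : Subgroup ℂˣ) : rootsIn A 1 = {1} := by
  ext x
  simp only [rootsIn, pow_one, Set.mem_ofPred_eq, Set.mem_singleton_iff]
  exact ⟨fun h => h.2, fun h => ⟨h ▸ A.one_mem, h⟩⟩

/-- The denominator is cleared to stay in `ℕ`, as the exponent `|G| - (k+1)` can be negative. The
excess of `k + 1` over the number of elements that are zero or generators is the number of trivial
factors, which is the power supplied by `prod_pairs_eq`. -/
theorem card_commutationSystem [∀ i, NeZero (n i)] (A : Subgroup ℂˣ) :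
    Nat.card {Q : ((i : ι) → ZMod (n i)) → ι → ℂˣ // IsCommutationSystem A Q} *
      (∏ i, (rootsIn A (n i)).ncard) ^ (Fintype.card ι + 1) =
    (∏ i, (rootsIn A (n i)).ncard) ^ Nat.card ((i : ι) → ZMod (n i)) *
      ∏ i, ∏ j, if i < j then (rootsIn A (n i * n j)).ncard else 1 := by
  classical
  have hcard : #{g : (i : ι) → ZMod (n i) | ¬ IsZeroOrGen g} + (#{i | ¬ n i = 1} + 1) =
      Nat.card ((i : ι) → ZMod (n i)) := by
    rw [← card_isZeroOrGen, Nat.card_eq_fintype_card, Nat.card_eq_fintype_card,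
      Fintype.card_subtype, add_comm, Finset.card_filter_add_card_filter_not, Finset.card_univ]
  have hι : #{i | n i = 1} + #{i | ¬ n i = 1} = Fintype.card ι := by
    rw [Finset.card_filter_add_card_filter_not, Finset.card_univ]
  rw [Nat.card_congr (commutationSystemEquiv A), Nat.card_prod]
  rw [Nat.card_pi, Nat.card_pi]
  simp only [Nat.card_pi (β := fun j => pairRoots n A _ j),
    Nat.card_pi (β := fun i => freeRoots A _ i), card_pairRoots, card_freeRoots]
  rw [prod_pairs_eq (fun i => n i = 1) (fun i => (rootsIn A (n i)).ncard)
    (fun i j => (rootsIn A (n i * n j)).ncard) (fun i h => by simp [h, rootsIn_one])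
    (fun i j h => by simp [h]) (fun i j h => by simp [h])]
  have hfree : (∏ g : (i : ι) → ZMod (n i), ∏ i, if IsZeroOrGen g then 1 else
      (rootsIn A (n i)).ncard) =
      (∏ i, (rootsIn A (n i)).ncard) ^ #{g : (i : ι) → ZMod (n i) | ¬ IsZeroOrGen g} := by
    rw [← Finset.prod_const, Finset.prod_filter]
    refine Finset.prod_congr rfl fun g _ => ?_
    split_ifs <;> simp
  rw [hfree, ← hι, ← hcard]
  ring

end Counting

/-! ### Classification and the final count -/

section Classification

open GradedTwistedAlgebra

variable {ι : Type} [Fintype ι] [LinearOrder ι] {n : ι → ℕ} [∀ i, NeZero (n i)]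
  [DecidableEq ((i : ι) → ZMod (n i))]

/-- The commutation system of a `(1,2)`-symmetric algebra. -/
noncomputable def commutationSystem {A : Subgroup ℂˣ}
    (W : {W : GradedTwistedAlgebra.{u} ((i : ι) → ZMod (n i)) ℂ //
      W.IsOneTwoSymmetric ∧ W.HasStructureConstantsIn A}) :
    {Q : ((i : ι) → ZMod (n i)) → ι → ℂˣ // IsCommutationSystem A Q} :=
  ⟨fun g i => W.2.2.exists_normalized.choose.commFactor g (gen n i),
    (GradedBasis.isQuasiCommutative _ W.2.1
      W.2.2.exists_normalized.choose_spec.1).isCommutationSystem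
      W.2.2.exists_normalized.choose_spec.2⟩

/-- Isomorphism classes of `(1,2)`-symmetric algebras correspond to commutation systems. -/
noncomputable def symmetricClassesEquiv (A : Subgroup ℂˣ) :
    SymmetricClasses.{u} ((i : ι) → ZMod (n i)) A ≃
      {Q : ((i : ι) → ZMod (n i)) → ι → ℂˣ // IsCommutationSystem A Q} :=
  Equiv.ofBijective
    (Quotient.lift commutationSystem fun W V h => Subtype.ext <| funext fun g => funext fun i =>
      GradedIsomorphic.commFactor_eq h _ _ g (gen n i)) <| by
    constructor
    · rintro ⟨W⟩ ⟨V⟩ h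
      refine Quotient.sound (?_ : GradedIsomorphic W.1 V.1)
      exact gradedIsomorphic_of_commFactor_eq W.2.1 V.2.1 _ _
        W.2.2.exists_normalized.choose_spec.1 V.2.2.exists_normalized.choose_spec.1
        fun g i => congrFun (congrFun (congrArg Subtype.val h) g) i
    · rintro ⟨Q, hQ⟩
      obtain ⟨C, hC, hCA, hCQ⟩ := hQ.exists_isQuasiCommutative
      obtain ⟨W, B, hB, hBC⟩ := exists_gradedBasis.{u} C hC.zero_left hC.zero_right
      have hBC' : B.structureConstant = C := funext fun a => funext (hBC a)
      refine ⟨Quotient.mk _ ⟨W, B.isOneTwoSymmetric (hBC' ▸ hC), B, fun a b => hBC a b ▸ hCA a b⟩,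
        Subtype.ext <| funext fun g => funext fun i => ?_⟩
      -- The normalized basis chosen for `W` need not be `B`, but commutation factors do not depend
      -- on the basis.
      refine Eq.trans (b := B.commFactor g (gen n i)) ?_
        (by rw [GradedBasis.commFactor, hBC, hBC, hCQ])
      exact (gradedIsomorphic_equivalence.refl W).commFactor_eq _ _ _ _

end Classification

theorem mainTheorem1 (k : ℕ) (n : Fin k → ℕ) (hn : ∀ i, 1 ≤ n i)
    (A : Subgroup ℂˣ) (hA : (A : Set ℂˣ).Finite) :
    Finite (GradedTwistedAlgebra.SymmetricClasses.{u} ((i : Fin k) → ZMod (n i)) A) ∧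
    (Nat.card (GradedTwistedAlgebra.SymmetricClasses.{u} ((i : Fin k) → ZMod (n i)) A) : ℚ) =
      (∏ i : Fin k, ((rootsIn A (n i)).ncard : ℚ) ^
          ((Nat.card ((i : Fin k) → ZMod (n i)) : ℤ) - ((k : ℤ) + 1))) *
        ∏ i : Fin k, ∏ j ∈ Finset.Ioi i, ((rootsIn A (n i * n j)).ncard : ℚ) := by
  have : ∀ i, NeZero (n i) := fun i => ⟨Nat.one_le_iff_ne_zero.1 (hn i)⟩
  -- Finiteness of `A` matters here: `ncard` would be `0` on an infinite set.
  have hR : ∀ m, (rootsIn A m).ncard ≠ 0 := fun m =>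
    (Set.ncard_pos (hA.subset fun _ h => h.1)).2 ⟨1, one_mem_rootsIn A m⟩ |>.ne'
  refine ⟨?_, ?_⟩
  · have : Finite A := hA
    have : Finite {Q : ((i : Fin k) → ZMod (n i)) → Fin k → ℂˣ // IsCommutationSystem A Q} :=
      Finite.of_injective (β := ((i : Fin k) → ZMod (n i)) → Fin k → A)
        (fun Q g i => ⟨Q.1 g i, Q.2.mem g i⟩) fun Q Q' h => Subtype.ext <| funext fun g =>
          funext fun i => congrArg Subtype.val (congrFun (congrFun h g) i)
    exact Finite.of_equiv _ (symmetricClassesEquiv A).symm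
  · have h := congrArg (Nat.cast : ℕ → ℚ) (card_commutationSystem (n := n) A)
    have hR' : (∏ i, ((rootsIn A (n i)).ncard : ℚ)) ≠ 0 :=
      Finset.prod_ne_zero_iff.2 fun i _ => Nat.cast_ne_zero.2 (hR _)
    have hIoi : ∀ i : Fin k, (∏ j ∈ Finset.Ioi i, ((rootsIn A (n i * n j)).ncard : ℚ)) =
        ∏ j, if i < j then ((rootsIn A (n i * n j)).ncard : ℚ) else 1 := by
      intro i
      rw [← Finset.prod_filter]
      congr 1
      ext j
      simp
    simp only [Nat.cast_mul, Nat.cast_pow, Nat.cast_prod, Nat.cast_ite, Nat.cast_one,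
      Fintype.card_fin] at h
    rw [Nat.card_congr (symmetricClassesEquiv A), Finset.prod_zpow, zpow_sub₀ hR', zpow_natCast,
      div_mul_eq_mul_div, eq_div_iff (zpow_ne_zero _ hR')]
    simp only [hIoi]
    exact_mod_cast h
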